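/- Throughout, $n$ ranges over the positive integers, $E$ over $\{D,U,L\}$, and $a$ over $0\le a\le n$ if $E=D$ and over $0\le a\le n-1$ if $E=U,L$. Let $(m_n)$ be a sequence of positive numbers. Put $$\Delta_n=m_n^2\begin{bmatrix}-2&1\\1&\ddots&\ddots\\&\ddots&\ddots&1\\&&1&-2\end{bmatrix},\qquad \Delta_n^w=\Delta_n+\mathrm{diag}_n(m_n^2w_n,0,\dots,0),\qquad (w_n)\subset\mathbb R,$$ and let $Q_n$ be the $(n+1)\times(n+1)$ tridiagonal random matrix with diagonal entries $D_n(a)$, upper diagonal entries $U_n(a)$ at $(a,a+1)$ and lower diagonal entries $L_n(a)$ at $(a+1,a)$, where $E_n(a)=V_n^E(a)+\xi_n^E(a)$ with $V^E_n(a)$ deterministic (potential terms) and $\xi_n^E(a)$ real random variables (noise terms). Consider the following conditions. (A1) There are $0<C\le1$ and $1/13<\mathfrak d<1/2$ with $Cn^{\mathfrak d}\le m_n\le C^{-1}n^{\mathfrak d}$ for all $n$. (A2) $m_n(1-w_n)\to w$ for some $w\in\mathbb R$. (A3) There are nonnegative continuous $V^D,V^U,V^L$ on $[0,\infty)$ with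 $V_n^E(\lfloor m_nx\rfloor)\to V^E(x)$ uniformly on compact sets, and $V:=\frac12(V^D+V^U+V^L)$ satisfies $V(x)/\log x\to\infty$ as $x\to\infty$. (A4) For every $E$: $0\le V_n^E(a)\le2m_n^2$ for all $a$ if $n$ is large, and $\max_{a\le C_n}V_n^E(a)=o(m_n^2)$ whenever $C_n=o(n)$. (A5) For at least one $E$: for every $\theta>0$ there are $c>0$ and $N$ with $\theta\log(1+a/m_n)-c\le V_n^E(a)\le m_n^2$ for all $n\ge N$ and all $a$. For at least one (possibly different) $E$: there are $\alpha$ with $\frac{\mathfrak d}{2(1-\mathfrak d)}<\alpha\le\frac{2\mathfrak d}{1-\mathfrak d}$ ($\mathfrak d$ as in (A1)) and $\varepsilon,\kappa,C>0$ such that, for $n$ large, $\kappa(a/m_n)^\alpha\le V_n^E(a)\le m_n^2$ for all $a\ge Cn^{1-\varepsilon}$. (A6) For every $n$ and $E$ the variables $\xi_n^E(a)$, over all $a$, are independent (the three vectors $\xi^D_n,\xi^U_n,\xi^L_n$ may depend on each other). (A7) For every $E$: $|\mathbf E[\xi_n^E(a)]|=o(m_{n-a}^{-1/2})$ as $n-a\to\infty$,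 and there are $C>0$, $0<\gamma<2/3$ such that, for $n$ large, $\mathbf E[|\xi_n^E(a)|^q]\le m_n^{q/2}C^qq^{\gamma q}$ for all $a$ and all integers $q\ge1$. (A8) There are Brownian motions $W^D,W^U,W^L$ on one probability space (started at $0$; the variance of an individual $W^E$ may be degenerate) such that $W:=\frac12(W^D+W^U+W^L)$ is a Brownian motion with variance $\sigma^2>0$, and such that for all continuous compactly supported $\phi_1,\dots,\phi_k$ on $[0,\infty)$ and all functions $\phi_i^{(n)}\to\phi_i$ converging uniformly and vanishing outside a common compact set, $$\Big(\tfrac1{m_n}\sum_{a=0}^{\lfloor m_nx\rfloor}\xi_n^E(a)\Big)_{x\ge0,\,E}\to\big(W^E(x)\big)_{x\ge0,\,E}\quad\text{and}\quad \Big(\sum_{a\ge0}\phi_i^{(n)}(a/m_n)\tfrac{\xi_n^E(a)}{m_n}\Big)_{E,i}\to\Big(\int_0^\infty\phi_i\,dW^E\Big)_{E,i}$$ jointly in distribution, the processes with respect to the Skorokhod topology on $D[0,\infty)$ (with $\xi_n^E(a):=0$ for $a$ out of range). (A9) $(D_n(0)/m_n^{1/2})_n$ is uniformly sub-Gaussian,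 where $(X_n)$ is uniformly sub-Gaussian if there are $C,c>0$ with $\sup_n\mathbf E[e^{y|X_n|}]\le Ce^{cy^2}$ for all $y\ge0$. The hypotheses of the Dirichlet limit theorem (Theorem 1) for $-\Delta_n+Q_n$ are (A1) and (A3)–(A8); the hypotheses of the Robin limit theorem (Theorem 2) for $-\Delta_n^w+Q_n$ are (A1)–(A9). **Corollary (Hermite).** Let $m_n=n^{1/3}$, and let $\xi_n^D\in\mathbb R^{n+1}$, $\xi_n^U=\xi_n^L\in\mathbb R^n$ be random vectors that satisfy (A6)–(A8), where $W$ has variance $\sigma^2=1/\beta$ with $\beta>0$. Let $H_n$ be the symmetric tridiagonal matrix with diagonal entries $-\xi_n^D(a)/n^{1/6}$, $0\le a\le n$, and off-diagonal entries $\chi_n(a)=\sqrt{n-a}-\xi_n^U(a)/n^{1/6}$, $0\le a\le n-1$, at $(a,a+1)$ and $(a+1,a)$, and put $R_n=n^{1/6}(2\sqrt n\,I_n-H_n)$. Then there are deterministic $V_n^E(a)$ such that, with $E_n(a)=V_n^E(a)+\xi_n^E(a)$ for the given noise terms, the corresponding $Q_n$ satisfies the following. 1. $R_n=-\Delta_n+Q_n$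 for all $n$, and this satisfies the hypotheses of Theorem 1 with $m_n=n^{1/3}$, with $V(x)=x/2$, and with the given $W$, of variance $1/\beta$. 2. Let $(\mu_n)$ be real numbers with $n^{-1/6}(\sqrt n-\mu_n)\to w\in\mathbb R$, suppose moreover that $(\xi_n^D(0)/n^{1/6})_n$ is uniformly sub-Gaussian, and put $H_n^w=H_n+\mathrm{diag}_n(\mu_n,0,\dots,0)$ and $R_n^w=n^{1/6}(2\sqrt n\,I_n-H_n^w)$. Then, with the same $Q_n$ and with $w_n=\mu_n/\sqrt n$, $R_n^w=-\Delta_n^w+Q_n$ for all $n$, and this satisfies the hypotheses of Theorem 2 with $m_n=n^{1/3}$, with this $w$ in (A2), with $V(x)=x/2$, and with the given $W$, of variance $1/\beta$. -/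

import Mathlib

open Filter Topology MeasureTheory ProbabilityTheory
open scoped NNReal ENNReal

namespace TridiagonalModel

noncomputable section

/-! ### Tridiagonal matrices -/

/-- The three kinds of entries of a tridiagonal matrix: diagonal, upper diagonal, lower diagonal. -/
inductive Entry : Type
  | D
  | U
  | L

/-- The number of entries of each kind in an `(n+1) × (n+1)` tridiagonal matrix:
`D` is indexed by `0 ≤ a ≤ n`, while `U` and `L` are indexed by `0 ≤ a ≤ n - 1`. -/
@[reducible] def Entry.size : Entry → ℕ → ℕ
  | .D, n => n + 1
  | .U, n => n
  | .L, n => n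

/-- Deterministic arrays `V^E_n(a)`. -/
abbrev PotentialArray : Type := (E : Entry) → (n : ℕ) → Fin (E.size n) → ℝ

/-- Arrays of random variables `X^E_n(a)`; for each `n` the variables live on a probability space
`Ω n` that may depend on `n`. -/
abbrev RandomArray.{u} (Ω : ℕ → Type u) : Type u :=
  (E : Entry) → (n : ℕ) → Fin (E.size n) → Ω n → ℝ

/-- The `(n+1) × (n+1)` tridiagonal matrix with diagonal `d`, entries `u a` at `(a, a+1)` and
entries `l a` at `(a+1, a)`. -/
def tridiag (n : ℕ) (d : Fin (n + 1) → ℝ) (u l : Fin n → ℝ) :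
    Matrix (Fin (n + 1)) (Fin (n + 1)) ℝ := fun i j =>
  if i = j then d i
  else if h : (i : ℕ) + 1 = j then u ⟨i, by omega⟩
  else if h : (j : ℕ) + 1 = i then l ⟨j, by omega⟩
  else 0

/-- The discrete Laplacian `Δ_n` with scale `m = m_n`. -/
def laplacian (m : ℝ) (n : ℕ) : Matrix (Fin (n + 1)) (Fin (n + 1)) ℝ :=
  m ^ 2 • tridiag n (fun _ => -2) (fun _ => 1) (fun _ => 1)

/-- The matrix `diag_n(x, 0, …, 0)`. -/
def corner (n : ℕ) (x : ℝ) : Matrix (Fin (n + 1)) (Fin (n + 1)) ℝ :=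
  Matrix.diagonal (Pi.single 0 x)

/-- The discrete Laplacian with spiked corner, `Δ^w_n = Δ_n + diag_n(m_n^2 w_n, 0, …, 0)`. -/
def laplacianSpiked (m w : ℝ) (n : ℕ) : Matrix (Fin (n + 1)) (Fin (n + 1)) ℝ :=
  laplacian m n + corner n (m ^ 2 * w)

/-- The random matrix `Q_n` with the entries `D_n(a)`, `U_n(a)`, `L_n(a)` of a random array. -/
def RandomArray.matrix {Ω : ℕ → Type*} (Q : RandomArray Ω) (n : ℕ) (ω : Ω n) :
    Matrix (Fin (n + 1)) (Fin (n + 1)) ℝ :=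
  tridiag n (fun a => Q .D n a ω) (fun a => Q .U n a ω) (fun a => Q .L n a ω)

/-! ### Hermite-type matrices -/

/-- The matrix `H_n` built from noise vectors `ξD = ξ^D_n` and `ξU = ξ^U_n = ξ^L_n`:
diagonal `-ξ^D_n(a) / n^{1/6}`, both off-diagonals `χ_n(a) = √(n - a) - ξ^U_n(a) / n^{1/6}`. -/
def hermite (n : ℕ) (ξD : Fin (n + 1) → ℝ) (ξU : Fin n → ℝ) :
    Matrix (Fin (n + 1)) (Fin (n + 1)) ℝ :=
  tridiag n (fun a => -ξD a / (n : ℝ) ^ (1 / 6 : ℝ))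
    (fun a => Real.sqrt ((n : ℝ) - (a : ℕ)) - ξU a / (n : ℝ) ^ (1 / 6 : ℝ))
    (fun a => Real.sqrt ((n : ℝ) - (a : ℕ)) - ξU a / (n : ℝ) ^ (1 / 6 : ℝ))

/-- The spiked matrix `H^w_n = H_n + diag_n(μ_n, 0, …, 0)`. -/
def hermiteSpiked (n : ℕ) (ξD : Fin (n + 1) → ℝ) (ξU : Fin n → ℝ) (μ : ℝ) :
    Matrix (Fin (n + 1)) (Fin (n + 1)) ℝ :=
  hermite n ξD ξU + corner n μ

/-- The edge rescaling `n^{1/6} (2 √n I_n - H)`. -/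
def edgeRescale (n : ℕ) (H : Matrix (Fin (n + 1)) (Fin (n + 1)) ℝ) :
    Matrix (Fin (n + 1)) (Fin (n + 1)) ℝ :=
  (n : ℝ) ^ (1 / 6 : ℝ) • ((2 * Real.sqrt n) • (1 : Matrix (Fin (n + 1)) (Fin (n + 1)) ℝ) - H)

/-! ### Growth of the scale and of the potential terms

All sequences are indexed by the positive integers; values at `n = 0` are never used, except that
convergence in distribution below also mentions the (irrelevant) term of index `0`. -/

/-- `C n^d ≤ m_n ≤ C⁻¹ n^d` for all `n ≥ 1`, with `0 < C ≤ 1` and `1/13 < d < 1/2`. -/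
def ScaleGrowth (m : ℕ → ℝ) (d : ℝ) : Prop :=
  1 / 13 < d ∧ d < 1 / 2 ∧ ∃ C : ℝ, 0 < C ∧ C ≤ 1 ∧
    ∀ n : ℕ, 1 ≤ n → C * (n : ℝ) ^ d ≤ m n ∧ m n ≤ C⁻¹ * (n : ℝ) ^ d

/-- Extension of a finite sequence by zero. -/
def extendZero {k : ℕ} (v : Fin k → ℝ) (j : ℕ) : ℝ := if h : j < k then v ⟨j, h⟩ else 0

/-- Potential convergence: `V^E_n(⌊m_n x⌋) → V^E(x)` uniformly on compact sets, for nonnegative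
continuous `V^E`, where `V = (V^D + V^U + V^L) / 2` satisfies `V(x) / log x → ∞`. (For `x` in a
compact set the index `⌊m_n x⌋` is in range as soon as `n` is large.) -/
def PotentialConvergence (m : ℕ → ℝ) (V : PotentialArray) (Vlim : ℝ≥0 → ℝ) : Prop :=
  ∃ VE : Entry → ℝ≥0 → ℝ,
    (∀ E, Continuous (VE E)) ∧ (∀ E x, 0 ≤ VE E x) ∧
    (∀ E, ∀ K : Set ℝ≥0, IsCompact K →
      TendstoUniformlyOn (fun (n : ℕ) (x : ℝ≥0) => extendZero (V E n) ⌊m n * x⌋₊)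
        (VE E) atTop K) ∧
    (∀ x, Vlim x = 1 / 2 * (VE .D x + VE .U x + VE .L x)) ∧
    Tendsto (fun x : ℝ≥0 => Vlim x / Real.log x) atTop atTop

/-- Growth upper bounds: `0 ≤ V^E_n(a) ≤ 2 m_n^2` for large `n`, and
`max_{a ≤ C_n} V^E_n(a) = o(m_n^2)` whenever `C_n = o(n)`. -/
def GrowthUpperBounds (m : ℕ → ℝ) (V : PotentialArray) : Prop :=
  ∀ E : Entry,
    (∀ᶠ n : ℕ in atTop, ∀ a : Fin (E.size n), 0 ≤ V E n a ∧ V E n a ≤ 2 * m n ^ 2) ∧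
    (∀ C : ℕ → ℝ, C =o[atTop] (fun n : ℕ => (n : ℝ)) →
      ∀ ε : ℝ, 0 < ε → ∀ᶠ n : ℕ in atTop, ∀ a : Fin (E.size n),
        ((a : ℕ) : ℝ) ≤ C n → |V E n a| ≤ ε * m n ^ 2)

/-- Growth lower bounds, with `d` the growth exponent of `m_n`. -/
def GrowthLowerBounds (m : ℕ → ℝ) (d : ℝ) (V : PotentialArray) : Prop :=
  (∃ E : Entry, ∀ θ : ℝ, 0 < θ → ∃ c : ℝ, 0 < c ∧ ∃ N : ℕ, ∀ n : ℕ, N ≤ n →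
    ∀ a : Fin (E.size n),
      θ * Real.log (1 + ((a : ℕ) : ℝ) / m n) - c ≤ V E n a ∧ V E n a ≤ m n ^ 2) ∧
  (∃ E : Entry, ∃ α : ℝ, d / (2 * (1 - d)) < α ∧ α ≤ 2 * d / (1 - d) ∧
    ∃ ε κ C : ℝ, 0 < ε ∧ 0 < κ ∧ 0 < C ∧ ∀ᶠ n : ℕ in atTop, ∀ a : Fin (E.size n),
      C * (n : ℝ) ^ (1 - ε) ≤ ((a : ℕ) : ℝ) →
        κ * (((a : ℕ) : ℝ) / m n) ^ α ≤ V E n a ∧ V E n a ≤ m n ^ 2)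

/-! ### Independence and moments of the noise terms -/

/-- For every `n` and every kind `E`, the variables `ξ^E_n(a)` are independent over `a`; nothing is
required between the three kinds. -/
def NoiseIndependence {Ω : ℕ → Type*} [∀ n, MeasurableSpace (Ω n)] (P : ∀ n, Measure (Ω n))
    (ξ : RandomArray Ω) : Prop :=
  ∀ n : ℕ, 1 ≤ n → ∀ E : Entry, iIndepFun (ξ E n) (P n)

/-- Moment asymptotics: `|𝔼 ξ^E_n(a)| = o(m_{n-a}^{-1/2})` as `n - a → ∞`, and
`𝔼 |ξ^E_n(a)|^q ≤ m_n^{q/2} C^q q^{γ q}` for all `a`, all integers `q ≥ 1` and all large `n`. -/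
def MomentAsymptotics {Ω : ℕ → Type*} [∀ n, MeasurableSpace (Ω n)] (P : ∀ n, Measure (Ω n))
    (m : ℕ → ℝ) (ξ : RandomArray Ω) : Prop :=
  ∀ E : Entry,
    (∀ ε : ℝ, 0 < ε → ∃ N : ℕ, ∀ n : ℕ, ∀ a : Fin (E.size n), N ≤ n - (a : ℕ) →
      Integrable (ξ E n a) (P n) ∧
        |∫ ω, ξ E n a ω ∂(P n)| ≤ ε * (m (n - (a : ℕ))) ^ (-(1 / 2) : ℝ)) ∧
    (∃ C γ : ℝ, 0 < C ∧ 0 < γ ∧ γ < 2 / 3 ∧ ∃ N : ℕ, ∀ n : ℕ, N ≤ n →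
      ∀ a : Fin (E.size n), ∀ q : ℕ, 1 ≤ q →
        ∫⁻ ω, ENNReal.ofReal (|ξ E n a ω| ^ q) ∂(P n) ≤
          ENNReal.ofReal (m n ^ ((q : ℝ) / 2) * C ^ q * (q : ℝ) ^ (γ * q)))

/-! ### The Skorokhod space -/

/-- Right-continuous real functions on `[0, ∞)` with left limits. -/
structure Cadlag where
  /-- The underlying function. -/
  toFun : ℝ≥0 → ℝ
  right_cont : ∀ x, ContinuousWithinAt toFun (Set.Ici x) x
  left_lim : ∀ x, ∃ l : ℝ, Tendsto toFun (𝓝[<] x) (𝓝 l)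

/-- `y` is within `ε` of `x` on `[0, T]`, up to a time change `lam` (an increasing bijection of
`[0, ∞)`) which moves the points of `[0, T]` by less than `ε`. -/
def Cadlag.Close (T : ℝ≥0) (ε : ℝ) (x y : Cadlag) : Prop :=
  ∃ lam : ℝ≥0 ≃o ℝ≥0, ∀ t : ℝ≥0, t ≤ T →
    |(lam t : ℝ) - t| < ε ∧ |y.toFun t - x.toFun (lam t)| < ε

lemma Cadlag.Close.mono {T T' : ℝ≥0} {ε ε' : ℝ} {x y : Cadlag} (hT : T' ≤ T) (hε : ε ≤ ε')
    (h : Cadlag.Close T ε x y) : Cadlag.Close T' ε' x y := by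
  obtain ⟨lam, h⟩ := h
  exact ⟨lam, fun t ht => ⟨((h t (ht.trans hT)).1).trans_le hε, ((h t (ht.trans hT)).2).trans_le hε⟩⟩

/-- The Skorokhod (J1) topology on `D[0, ∞)`: the sets `{y | Close T ε x y}`, `T ≥ 0`, `ε > 0`, are a
neighbourhood basis at `x`. Thus `y_n → x` if and only if for every `T` there are time changes
`lam_n` with `sup_{t ≤ T} |lam_n t - t| → 0` and `sup_{t ≤ T} |y_n t - x (lam_n t)| → 0`. -/
instance : TopologicalSpace Cadlag where
  IsOpen s := ∀ x ∈ s, ∃ T : ℝ≥0, ∃ ε : ℝ, 0 < ε ∧ ∀ y, Cadlag.Close T ε x y → y ∈ s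
  isOpen_univ := fun _ _ => ⟨0, 1, one_pos, fun _ _ => Set.mem_univ _⟩
  isOpen_inter := by
    rintro s t hs ht x ⟨hxs, hxt⟩
    obtain ⟨T₁, ε₁, h₁, H₁⟩ := hs x hxs
    obtain ⟨T₂, ε₂, h₂, H₂⟩ := ht x hxt
    exact ⟨max T₁ T₂, min ε₁ ε₂, lt_min h₁ h₂, fun y hy =>
      ⟨H₁ y (hy.mono (le_max_left _ _) (min_le_left _ _)),
        H₂ y (hy.mono (le_max_right _ _) (min_le_right _ _))⟩⟩
  isOpen_sUnion := by
    intro S hS x hx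
    obtain ⟨s, hs, hxs⟩ := hx
    obtain ⟨T, ε, h, H⟩ := hS s hs x hxs
    exact ⟨T, ε, h, fun y hy => ⟨s, hs, H y hy⟩⟩

/-- A continuous function, as an element of the Skorokhod space. -/
def Cadlag.ofContinuous (f : C(ℝ≥0, ℝ)) : Cadlag where
  toFun := f
  right_cont _ := f.continuous.continuousWithinAt
  left_lim x := ⟨f x, f.continuous.continuousAt.tendsto.mono_left nhdsWithin_le_nhds⟩

/-- The step function `x ↦ g ⌊m x⌋`, as an element of the Skorokhod space. -/
def Cadlag.ofFloor (m : ℝ) (g : ℕ → ℝ) : Cadlag where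
  toFun x := g ⌊m * x⌋₊
  right_cont x := by
    rcases le_or_gt m 0 with hm | hm
    · have h : (fun x : ℝ≥0 => g ⌊m * x⌋₊) = fun _ => g 0 := by
        funext y
        rw [Nat.floor_of_nonpos (mul_nonpos_of_nonpos_of_nonneg hm y.coe_nonneg)]
      rw [h]
      exact continuousWithinAt_const
    · have hx : m * (x : ℝ) < ⌊m * x⌋₊ + 1 := Nat.lt_floor_add_one _
      have hc : ContinuousAt (fun y : ℝ≥0 => m * (y : ℝ)) x := by fun_prop
      have h1 : ∀ᶠ y : ℝ≥0 in 𝓝[≥] x, m * (y : ℝ) < ⌊m * x⌋₊ + 1 :=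
        (hc.eventually_lt_const hx).filter_mono nhdsWithin_le_nhds
      refine (tendsto_const_nhds (x := g ⌊m * x⌋₊)).congr' ?_
      filter_upwards [h1, self_mem_nhdsWithin] with y hy hxy
      have hxy' : (x : ℝ) ≤ y := hxy
      congr 1
      symm
      rw [Nat.floor_eq_iff (by positivity)]
      exact ⟨(Nat.floor_le (by positivity)).trans (by gcongr), hy⟩
  left_lim x := by
    rcases le_or_gt m 0 with hm | hm
    · have h : (fun x : ℝ≥0 => g ⌊m * x⌋₊) = fun _ => g 0 := by
        funext y
        rw [Nat.floor_of_nonpos (mul_nonpos_of_nonpos_of_nonneg hm y.coe_nonneg)]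
      rw [h]
      exact ⟨g 0, tendsto_const_nhds⟩
    · refine ⟨g (⌈m * x⌉₊ - 1), ?_⟩
      rcases eq_or_lt_of_le (show 0 ≤ x from zero_le) with h0 | h0
      · have : 𝓝[<] x = ⊥ := by
          have : Set.Iio x = ∅ := by
            rw [← h0]
            ext y
            simp
          rw [this, nhdsWithin_empty]
        rw [this]
        exact tendsto_bot
      · have hx0 : 0 < m * (x : ℝ) := mul_pos hm h0
        have hc1 : 1 ≤ ⌈m * (x : ℝ)⌉₊ := Nat.ceil_pos.2 hx0
        have hx : ((⌈m * (x : ℝ)⌉₊ - 1 : ℕ) : ℝ) < m * x := by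
          apply Nat.lt_ceil.1
          omega
        have hc : ContinuousAt (fun y : ℝ≥0 => m * (y : ℝ)) x := by fun_prop
        have h1 : ∀ᶠ y : ℝ≥0 in 𝓝[<] x, ((⌈m * (x : ℝ)⌉₊ - 1 : ℕ) : ℝ) < m * y :=
          (hc.eventually_const_lt hx).filter_mono nhdsWithin_le_nhds
        refine (tendsto_const_nhds (x := g (⌈m * x⌉₊ - 1))).congr' ?_
        filter_upwards [h1, self_mem_nhdsWithin] with y hy hxy
        have hxy' : (y : ℝ) < x := hxy
        congr 1
        symm
        rw [Nat.floor_eq_iff (by positivity)]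
        refine ⟨hy.le, ?_⟩
        have h2 : m * (y : ℝ) < m * x := by gcongr
        have h3 : m * (x : ℝ) ≤ ⌈m * (x : ℝ)⌉₊ := Nat.le_ceil _
        have h4 : ((⌈m * (x : ℝ)⌉₊ - 1 : ℕ) : ℝ) + 1 = ⌈m * (x : ℝ)⌉₊ := by
          exact_mod_cast Nat.sub_add_cancel hc1
        linarith

/-- The rescaled partial-sum process `x ↦ m⁻¹ ∑_{a=0}^{⌊m x⌋} v(a)` of a finite sequence `v`
(terms out of range count as zero). -/
def partialSumProcess (m : ℝ) {k : ℕ} (v : Fin k → ℝ) : Cadlag :=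
  Cadlag.ofFloor m fun j => 1 / m * ∑ a ∈ Finset.range (j + 1), extendZero v a

/-- The space `D[0, ∞)^{D,U,L} × ℝ^{{D,U,L} × k}`, with its product topology and the Borel
σ-algebra. -/
def JointSpace (k : ℕ) : Type := (Entry → Cadlag) × (Entry → Fin k → ℝ)

instance (k : ℕ) : TopologicalSpace (JointSpace k) :=
  inferInstanceAs (TopologicalSpace ((Entry → Cadlag) × (Entry → Fin k → ℝ)))

instance (k : ℕ) : MeasurableSpace (JointSpace k) := borel (JointSpace k)

instance (k : ℕ) : BorelSpace (JointSpace k) := ⟨rfl⟩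

/-! ### Brownian limits of the noise terms -/

/-- Brownian motion with variance `v` (started at `0`), with continuous paths. -/
structure IsBrownianMotion {Ω : Type*} [MeasurableSpace Ω] (P : Measure Ω) (v : ℝ≥0)
    (B : Ω → C(ℝ≥0, ℝ)) : Prop where
  indep : HasIndepIncrements (fun (t : ℝ≥0) (ω : Ω) => B ω t) P
  law : ∀ t : ℝ≥0, HasLaw (fun ω => B ω t) (gaussianReal 0 (v * t)) P

/-- `I = ∫_0^∞ φ dB` for a continuous compactly supported `φ`: the limit in probability of the
Riemann sums along dyadic subdivisions. -/
def IsWienerIntegral {Ω : Type*} [MeasurableSpace Ω] (P : Measure Ω)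
    (B : Ω → C(ℝ≥0, ℝ)) (φ : ℝ≥0 → ℝ) (I : Ω → ℝ) : Prop :=
  TendstoInMeasure P
    (fun (N : ℕ) (ω : Ω) => ∑ j ∈ Finset.range (N * 2 ^ N),
      φ ((j : ℝ≥0) / 2 ^ N) * (B ω (((j : ℝ≥0) + 1) / 2 ^ N) - B ω ((j : ℝ≥0) / 2 ^ N)))
    atTop I

/-- Noise convergence. The limits `W^E` are Brownian motions on a common probability space (their
variances are arbitrary; zero is allowed for individual `E`), `W = (W^D + W^U + W^L) / 2` is a
Brownian motion with variance `σ2 > 0`, and for all continuous compactly supported `φ_1, …, φ_k`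
and all `φ^{(n)}_i → φ_i` uniformly with supports in a common compact set, the partial-sum processes
and the sums `∑_a φ^{(n)}_i(a / m_n) ξ^E_n(a) / m_n` converge jointly in distribution to the `W^E` and
the integrals `∫ φ_i dW^E`. -/
def NoiseConvergence {Ω : ℕ → Type*} [∀ n, MeasurableSpace (Ω n)] (P : ∀ n, Measure (Ω n))
    [∀ n, IsProbabilityMeasure (P n)] (m : ℕ → ℝ) (ξ : RandomArray Ω)
    {Ω' : Type*} [MeasurableSpace Ω'] (P' : Measure Ω') [IsProbabilityMeasure P']
    (W : Entry → Ω' → C(ℝ≥0, ℝ)) (σ2 : ℝ≥0) : Prop :=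
  (∀ E, ∃ v : ℝ≥0, IsBrownianMotion P' v (W E)) ∧
  0 < σ2 ∧
  IsBrownianMotion P' σ2 (fun ω => (1 / 2 : ℝ) • (W .D ω + W .U ω + W .L ω)) ∧
  ∀ (k : ℕ) (φ : Fin k → ℝ≥0 → ℝ) (φn : Fin k → ℕ → ℝ≥0 → ℝ),
    (∀ i, Continuous (φ i)) → (∀ i, HasCompactSupport (φ i)) →
    (∀ i, TendstoUniformly (φn i) (φ i) atTop) →
    (∃ M : ℝ≥0, ∀ i n x, M < x → φn i n x = 0) →
    ∃ I : Entry → Fin k → Ω' → ℝ,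
      (∀ E i, IsWienerIntegral P' (W E) (φ i) (I E i)) ∧
      TendstoInDistribution (E := JointSpace k)
        (fun (n : ℕ) (ω : Ω n) =>
          ((fun E => partialSumProcess (m n) (fun a => ξ E n a ω)),
            (fun E i => ∑ a : Fin (E.size n),
              φn i n ((a : ℕ) / Real.toNNReal (m n)) * (ξ E n a ω / m n))))
        atTop
        (fun ω => ((fun E => Cadlag.ofContinuous (W E ω)), (fun E i => I E i ω)))
        P P'

/-! ### The hypotheses of the two limit theorems -/

/-- A sequence of random variables is uniformly sub-Gaussian if
`sup_n 𝔼 exp(y |X_n|) ≤ C exp(c y^2)` for all `y ≥ 0`. -/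
def UniformlySubGaussian {Ω : ℕ → Type*} [∀ n, MeasurableSpace (Ω n)] (P : ∀ n, Measure (Ω n))
    (X : (n : ℕ) → Ω n → ℝ) : Prop :=
  ∃ C c : ℝ, 0 < C ∧ 0 < c ∧ ∀ n : ℕ, 1 ≤ n → ∀ y : ℝ, 0 ≤ y →
    ∫⁻ ω, ENNReal.ofReal (Real.exp (y * |X n ω|)) ∂(P n) ≤
      ENNReal.ofReal (C * Real.exp (c * y ^ 2))

/-- The hypotheses of the limit theorem for `-Δ_n + Q_n` (Dirichlet boundary condition), where `Q`
has potential terms `V` and noise terms `ξ`, with limiting potential `Vlim`, and limiting noise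
`W = (W^D + W^U + W^L) / 2` of variance `σ2`. -/
def DirichletHypotheses {Ω : ℕ → Type*} [∀ n, MeasurableSpace (Ω n)] (P : ∀ n, Measure (Ω n))
    [∀ n, IsProbabilityMeasure (P n)] (m : ℕ → ℝ) (Q : RandomArray Ω) (V : PotentialArray)
    (ξ : RandomArray Ω) (Vlim : ℝ≥0 → ℝ)
    {Ω' : Type*} [MeasurableSpace Ω'] (P' : Measure Ω') [IsProbabilityMeasure P']
    (W : Entry → Ω' → C(ℝ≥0, ℝ)) (σ2 : ℝ≥0) : Prop :=
  (∀ E n a, Measurable (ξ E n a)) ∧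
  (∀ E n a ω, Q E n a ω = V E n a + ξ E n a ω) ∧
  (∃ d : ℝ, ScaleGrowth m d ∧ GrowthLowerBounds m d V) ∧
  PotentialConvergence m V Vlim ∧
  GrowthUpperBounds m V ∧
  NoiseIndependence P ξ ∧
  MomentAsymptotics P m ξ ∧
  NoiseConvergence P m ξ P' W σ2

/-- The hypotheses of the limit theorem for `-Δ^w_n + Q_n` (Robin boundary condition), where `wn` is
the spike sequence and `w` is the limit of `m_n (1 - w_n)`. -/
def RobinHypotheses {Ω : ℕ → Type*} [∀ n, MeasurableSpace (Ω n)] (P : ∀ n, Measure (Ω n))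
    [∀ n, IsProbabilityMeasure (P n)] (m : ℕ → ℝ) (wn : ℕ → ℝ) (w : ℝ) (Q : RandomArray Ω)
    (V : PotentialArray) (ξ : RandomArray Ω) (Vlim : ℝ≥0 → ℝ)
    {Ω' : Type*} [MeasurableSpace Ω'] (P' : Measure Ω') [IsProbabilityMeasure P']
    (W : Entry → Ω' → C(ℝ≥0, ℝ)) (σ2 : ℝ≥0) : Prop :=
  DirichletHypotheses P m Q V ξ Vlim P' W σ2 ∧
  Tendsto (fun n => m n * (1 - wn n)) atTop (𝓝 w) ∧
  UniformlySubGaussian P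
    (fun n ω => Q .D n (0 : Fin (n + 1)) ω / (m n) ^ (1 / 2 : ℝ))

end

end TridiagonalModel

open TridiagonalModel

namespace TridiagonalModel

/-! Write `m = n^{1/3}`. Since `n^{1/6} √n = m²`, the diagonal of `R_n` is `2m² + ξ^D`, and its
off-diagonal entries are `-n^{1/6} √(n-a) + ξ^U = -m² + n^{1/6} (√n - √(n-a)) + ξ^U`. Removing
`-Δ_n` therefore leaves exactly the given noise and forces `V^D = 0` and `V^U = V^L = n^{1/6} (√n -
√(n-a))`. The noise hypotheses carry over unchanged; only the potential has to be studied.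

Rationalizing, `V^U = n^{1/6} a / (√n + √(n-a))`, which lies between `a/(2m)` and `a/m`
(`le_hermiteOffDiagonal`, `hermiteOffDiagonal_le`); this gives all the growth bounds. For bounded
`a/m` the square roots agree to leading order, so `V^U` is `a/(2m)` up to `O(m⁻²)`
(`hermiteOffDiagonal_sub_le`). Both off-diagonal limits are thus `x/2`, and half their sum is again
`x/2`.

A spike `μ` in `H_n` becomes `n^{1/6} μ = m² (μ/√n)`, and `m (1 - μ/√n) = n^{-1/6} (√n - μ)`. As
`V^D = 0`, the corner condition on `D_n(0)` is one on `ξ^D_n(0)`. -/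

/-- The off-diagonal potential `n^{1/6} (√n - √(n - a))` of the Hermite-type matrices. -/
noncomputable def hermiteOffDiagonal (n a : ℕ) : ℝ :=
  (n : ℝ) ^ (1 / 6 : ℝ) * (Real.sqrt n - Real.sqrt ((n : ℝ) - a))

/-- The potential terms of the Hermite-type matrices: zero on the diagonal. -/
noncomputable def hermitePotential : PotentialArray
  | .D, _, _ => 0
  | .U, n, a => hermiteOffDiagonal n a
  | .L, n, a => hermiteOffDiagonal n a

/-! ### Fractional powers of `n` as integer powers of its sixth root. -/

section Powers

lemma sixthRoot_pos {n : ℕ} (hn : 1 ≤ n) : 0 < (n : ℝ) ^ (1 / 6 : ℝ) :=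
  Real.rpow_pos_of_pos (by exact_mod_cast hn) _

lemma cubeRoot_eq_sixthRoot_sq (n : ℕ) :
    (n : ℝ) ^ (1 / 3 : ℝ) = ((n : ℝ) ^ (1 / 6 : ℝ)) ^ 2 := by
  rw [← Real.rpow_natCast, ← Real.rpow_mul (Nat.cast_nonneg n)]
  norm_num

lemma eq_sixthRoot_pow (n : ℕ) : (n : ℝ) = ((n : ℝ) ^ (1 / 6 : ℝ)) ^ 6 := by
  rw [← Real.rpow_natCast, ← Real.rpow_mul (Nat.cast_nonneg n)]
  norm_num

lemma sqrt_eq_sixthRoot_pow (n : ℕ) : Real.sqrt n = ((n : ℝ) ^ (1 / 6 : ℝ)) ^ 3 := by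
  rw [← Real.rpow_natCast, ← Real.rpow_mul (Nat.cast_nonneg n), Real.sqrt_eq_rpow]
  norm_num

lemma cubeRoot_rpow_half (n : ℕ) :
    ((n : ℝ) ^ (1 / 3 : ℝ)) ^ (1 / 2 : ℝ) = (n : ℝ) ^ (1 / 6 : ℝ) := by
  rw [← Real.rpow_mul (Nat.cast_nonneg n)]
  norm_num

lemma tendsto_cubeRoot_atTop : Tendsto (fun n : ℕ => (n : ℝ) ^ (1 / 3 : ℝ)) atTop atTop :=
  (tendsto_rpow_atTop (by norm_num)).comp tendsto_natCast_atTop_atTop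

end Powers

/-! ### Two-sided estimates for the off-diagonal potential. -/

section OffDiagonal

variable {n a : ℕ}

/-- The off-diagonal potential in terms of the sixth root `r` of `n` and `s = √(n - a)`. -/
lemma exists_hermiteOffDiagonal_eq (hn : 1 ≤ n) (ha : a ≤ n) :
    ∃ r s : ℝ, 0 < r ∧ 0 ≤ s ∧ s ≤ r ^ 3 ∧ (n : ℝ) ^ (1 / 3 : ℝ) = r ^ 2 ∧
      (a : ℝ) = (r ^ 3 - s) * (r ^ 3 + s) ∧ hermiteOffDiagonal n a = r * (r ^ 3 - s) := by
  have ha' : (a : ℝ) ≤ n := by exact_mod_cast ha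
  refine ⟨(n : ℝ) ^ (1 / 6 : ℝ), Real.sqrt ((n : ℝ) - a), sixthRoot_pos hn, Real.sqrt_nonneg _,
    ?_, cubeRoot_eq_sixthRoot_sq n, ?_, ?_⟩
  · rw [← sqrt_eq_sixthRoot_pow]
    exact Real.sqrt_le_sqrt (by linarith [(Nat.cast_nonneg a : (0 : ℝ) ≤ a)])
  · have h1 := Real.sq_sqrt (sub_nonneg.2 ha')
    have h2 := eq_sixthRoot_pow n
    linear_combination h1 + h2
  · rw [hermiteOffDiagonal, ← sqrt_eq_sixthRoot_pow]

lemma hermiteOffDiagonal_nonneg (hn : 1 ≤ n) (ha : a ≤ n) : 0 ≤ hermiteOffDiagonal n a := by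
  obtain ⟨r, s, hr, -, hs, -, -, h⟩ := exists_hermiteOffDiagonal_eq hn ha
  rw [h]
  exact mul_nonneg hr.le (sub_nonneg.2 hs)

lemma hermiteOffDiagonal_le_sq (hn : 1 ≤ n) (ha : a ≤ n) :
    hermiteOffDiagonal n a ≤ ((n : ℝ) ^ (1 / 3 : ℝ)) ^ 2 := by
  obtain ⟨r, s, hr, hs0, -, hm, -, h⟩ := exists_hermiteOffDiagonal_eq hn ha
  rw [h, hm]
  nlinarith [mul_nonneg hr.le hs0]

/-- With `r`, `s` as in `exists_hermiteOffDiagonal_eq`, the gap between the two sides is exactly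
`(r³ - s)² / (2r²)`. -/
lemma le_hermiteOffDiagonal (hn : 1 ≤ n) (ha : a ≤ n) :
    a / (n : ℝ) ^ (1 / 3 : ℝ) / 2 ≤ hermiteOffDiagonal n a := by
  obtain ⟨r, s, hr, hs0, hs, hm, ha', h⟩ := exists_hermiteOffDiagonal_eq hn ha
  rw [h, hm, ha', div_div, div_le_iff₀ (by positivity)]
  have : 0 ≤ (r ^ 3 - s) * (r ^ 3 - s) := mul_self_nonneg _
  nlinarith

/-- Here the gap is `(r³ - s) s / r²`. -/
lemma hermiteOffDiagonal_le (hn : 1 ≤ n) (ha : a ≤ n) :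
    hermiteOffDiagonal n a ≤ a / (n : ℝ) ^ (1 / 3 : ℝ) := by
  obtain ⟨r, s, hr, hs0, hs, hm, ha', h⟩ := exists_hermiteOffDiagonal_eq hn ha
  rw [h, hm, ha', le_div_iff₀ (by positivity)]
  have : 0 ≤ (r ^ 3 - s) * s := mul_nonneg (sub_nonneg.2 hs) hs0
  nlinarith

/-- The left side equals `(r³ - s)² / (2r²)`, and `(r³ - s) r³ ≤ (r³ - s)(r³ + s) = a`. This is the
error in the convergence to `x/2`. -/
lemma hermiteOffDiagonal_sub_le (hn : 1 ≤ n) (ha : a ≤ n) :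
    hermiteOffDiagonal n a - a / (n : ℝ) ^ (1 / 3 : ℝ) / 2 ≤
      (a / (n : ℝ) ^ (1 / 3 : ℝ)) ^ 2 / (2 * ((n : ℝ) ^ (1 / 3 : ℝ)) ^ 2) := by
  obtain ⟨r, s, hr, hs0, hs, hm, ha', h⟩ := exists_hermiteOffDiagonal_eq hn ha
  rw [h, hm, ha', div_pow, div_div, div_div, le_div_iff₀ (by positivity)]
  have h1 : (r * (r ^ 3 - s) - (r ^ 3 - s) * (r ^ 3 + s) / (r ^ 2 * 2)) *
      ((r ^ 2) ^ 2 * (2 * (r ^ 2) ^ 2)) = ((r ^ 3 - s) * r ^ 3) ^ 2 := by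
    field_simp
    ring
  rw [h1]
  have h2 : 0 ≤ r ^ 3 - s := sub_nonneg.2 hs
  gcongr
  linarith

end OffDiagonal

/-! ### Scale, growth and convergence hypotheses for the potential. -/

section Hypotheses

lemma scaleGrowth_cubeRoot : ScaleGrowth (fun n : ℕ => (n : ℝ) ^ (1 / 3 : ℝ)) (1 / 3) :=
  ⟨by norm_num, by norm_num, 1, one_pos, le_rfl, fun n _ => by simp⟩

lemma growthUpperBounds_hermitePotential :
    GrowthUpperBounds (fun n : ℕ => (n : ℝ) ^ (1 / 3 : ℝ)) hermitePotential := by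
  have key : ∀ C : ℕ → ℝ, C =o[atTop] (fun n : ℕ => (n : ℝ)) → ∀ ε : ℝ, 0 < ε →
      ∀ᶠ n : ℕ in atTop, ∀ a : Fin n, ((a : ℕ) : ℝ) ≤ C n →
        |hermiteOffDiagonal n a| ≤ ε * ((n : ℝ) ^ (1 / 3 : ℝ)) ^ 2 := by
    intro C hC ε hε
    filter_upwards [hC.bound hε, eventually_ge_atTop 1] with n hn h1 a ha
    rw [abs_of_nonneg (hermiteOffDiagonal_nonneg h1 a.2.le)]
    refine (hermiteOffDiagonal_le h1 a.2.le).trans ?_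
    rw [div_le_iff₀ (by rw [cubeRoot_eq_sixthRoot_sq]; have := sixthRoot_pos h1; positivity)]
    have h2 : ((a : ℕ) : ℝ) ≤ ε * n := by
      refine ha.trans ((le_abs_self _).trans ?_)
      simpa using hn
    -- Now `a/m ≤ εn/m`, and `n = m³` turns this into `ε m²`.
    refine h2.trans_eq ?_
    rw [cubeRoot_eq_sixthRoot_sq]
    linear_combination ε * eq_sixthRoot_pow n
  have bounds : ∀ᶠ n : ℕ in atTop, ∀ a : Fin n, 0 ≤ hermiteOffDiagonal n a ∧
      hermiteOffDiagonal n a ≤ 2 * ((n : ℝ) ^ (1 / 3 : ℝ)) ^ 2 := by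
    filter_upwards [eventually_ge_atTop 1] with n h1 a
    refine ⟨hermiteOffDiagonal_nonneg h1 a.2.le, (hermiteOffDiagonal_le_sq h1 a.2.le).trans ?_⟩
    linarith [sq_nonneg ((n : ℝ) ^ (1 / 3 : ℝ))]
  rintro (_ | _ | _)
  · refine ⟨Eventually.of_forall fun n a => ⟨le_rfl, ?_⟩,
      fun C _ ε hε => Eventually.of_forall fun n a _ => ?_⟩
    · simp only [hermitePotential]
      positivity
    · simp only [hermitePotential, abs_zero]
      positivity
  · exact ⟨bounds, key⟩
  · exact ⟨bounds, key⟩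

/-- By concavity `θ log (1 + y)` lies below its tangent of slope `1/2`, which touches it at `1 + y =
2θ`. -/
lemma exists_mul_log_one_add_sub_le {θ : ℝ} (hθ : 0 < θ) :
    ∃ c : ℝ, 0 < c ∧ ∀ y : ℝ, 0 ≤ y → θ * Real.log (1 + y) - c ≤ y / 2 := by
  refine ⟨1 / 2 + θ * |Real.log (2 * θ)|, by positivity, fun y hy => ?_⟩
  have h0 : 0 < (1 + y) / (2 * θ) := by positivity
  have h1 := Real.log_le_sub_one_of_pos h0
  rw [Real.log_div (by positivity) (by positivity)] at h1
  have h2 := mul_le_mul_of_nonneg_left h1 hθ.le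
  have h3 : θ * ((1 + y) / (2 * θ) - 1) = (1 + y) / 2 - θ := by
    field_simp
  have h4 := mul_le_mul_of_nonneg_left (le_abs_self (Real.log (2 * θ))) hθ.le
  rw [h3] at h2
  linarith

lemma growthLowerBounds_hermitePotential :
    GrowthLowerBounds (fun n : ℕ => (n : ℝ) ^ (1 / 3 : ℝ)) (1 / 3) hermitePotential := by
  -- For `d = 1/3` the admissible exponents are `1/4 < α ≤ 1`, so the linear bound is just enough.
  -- It holds with `κ = 1/2` for every `a`, so any positive `ε` and `C` serve.
  refine ⟨⟨.U, fun θ hθ => ?_⟩, ⟨.U, 1, by norm_num, by norm_num, 1, 1 / 2, 1, one_pos,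
    by norm_num, one_pos, ?_⟩⟩
  · obtain ⟨c, hc, h⟩ := exists_mul_log_one_add_sub_le hθ
    exact ⟨c, hc, 1, fun n hn a => ⟨(h _ (by positivity)).trans (le_hermiteOffDiagonal hn a.2.le),
      hermiteOffDiagonal_le_sq hn a.2.le⟩⟩
  · filter_upwards [eventually_ge_atTop 1] with n hn a _
    refine ⟨?_, hermiteOffDiagonal_le_sq hn a.2.le⟩
    rw [Real.rpow_one, one_div_mul_eq_div]
    exact le_hermiteOffDiagonal hn a.2.le

lemma tendstoUniformlyOn_hermiteOffDiagonal {K : Set ℝ≥0} (hK : IsCompact K) :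
    TendstoUniformlyOn (fun (n : ℕ) (x : ℝ≥0) =>
      extendZero (fun a : Fin n => hermiteOffDiagonal n a) ⌊(n : ℝ) ^ (1 / 3 : ℝ) * x⌋₊)
      (fun x => (x : ℝ) / 2) atTop K := by
  obtain ⟨M, hM⟩ := hK.bddAbove
  rw [Metric.tendstoUniformlyOn_iff]
  intro ε hε
  -- The first term bounds the quadratic error at `a/m ≤ M`; the second is half the rounding error
  -- `1/m` of the floor.
  have hlim : Tendsto (fun n : ℕ => (M : ℝ) ^ 2 / (2 * ((n : ℝ) ^ (1 / 3 : ℝ)) ^ 2) +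
      1 / (2 * (n : ℝ) ^ (1 / 3 : ℝ))) atTop (𝓝 0) := by
    have h1 : Tendsto (fun n : ℕ => 2 * (n : ℝ) ^ (1 / 3 : ℝ)) atTop atTop :=
      tendsto_cubeRoot_atTop.const_mul_atTop two_pos
    have h2 : Tendsto (fun n : ℕ => 2 * ((n : ℝ) ^ (1 / 3 : ℝ)) ^ 2) atTop atTop :=
      ((tendsto_pow_atTop two_ne_zero).comp tendsto_cubeRoot_atTop).const_mul_atTop two_pos
    simpa using (h2.const_div_atTop ((M : ℝ) ^ 2)).add (h1.const_div_atTop 1)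
  filter_upwards [hlim.eventually_lt_const hε, eventually_ge_atTop 1,
    tendsto_cubeRoot_atTop.eventually_gt_atTop ((M : ℝ) + 1)] with n hn h1 hMn x hx
  have hxM : (x : ℝ) ≤ M := by exact_mod_cast hM hx
  have hcube : (n : ℝ) = ((n : ℝ) ^ (1 / 3 : ℝ)) ^ 3 := by
    rw [cubeRoot_eq_sixthRoot_sq]
    linear_combination eq_sixthRoot_pow n
  set m := (n : ℝ) ^ (1 / 3 : ℝ) with hm
  have hM0 : (0 : ℝ) ≤ M := M.coe_nonneg
  have hx0 : (0 : ℝ) ≤ x := x.coe_nonneg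
  have hm0 : 0 < m := by linarith
  have hfl : (⌊m * x⌋₊ : ℝ) ≤ m * x := Nat.floor_le (by positivity)
  have hfl' : m * x < ⌊m * x⌋₊ + 1 := Nat.lt_floor_add_one _
  -- The index must be in range, where `extendZero` is not its default `0`: `m x ≤ m M < m² ≤ m³ =
  -- n` because `m > M + 1`.
  have hlt : ⌊m * x⌋₊ < n := by
    have : (⌊m * x⌋₊ : ℝ) < n := by
      rw [hcube]
      have h2 : m * x ≤ m * M := by gcongr
      have h3 : m * M < m * m := by
        apply mul_lt_mul_of_pos_left _ hm0
        linarith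
      have h4 : m * m ≤ m * m * m := le_mul_of_one_le_right (by positivity) (by linarith)
      nlinarith
    exact_mod_cast this
  have hquot : (⌊m * x⌋₊ : ℝ) / m ≤ x := by
    rw [div_le_iff₀ hm0]
    linarith
  have hquot' : x - 1 / m ≤ (⌊m * x⌋₊ : ℝ) / m := by
    rw [le_div_iff₀ hm0, sub_mul, one_div_mul_cancel hm0.ne']
    linarith
  have hlow := le_hermiteOffDiagonal h1 hlt.le
  have hupp := hermiteOffDiagonal_sub_le h1 hlt.le
  rw [← hm] at hlow hupp
  have hsq : ((⌊m * x⌋₊ : ℝ) / m) ^ 2 / (2 * m ^ 2) ≤ (M : ℝ) ^ 2 / (2 * m ^ 2) := by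
    have : (⌊m * x⌋₊ : ℝ) / m ≤ M := hquot.trans hxM
    gcongr
  have hhalf : 1 / (2 * m) = 1 / m / 2 := by
    rw [div_div, mul_comm]
  have hp1 : 0 ≤ (M : ℝ) ^ 2 / (2 * m ^ 2) := by positivity
  have hp2 : 0 < 1 / m := by positivity
  rw [extendZero, dif_pos hlt, Real.dist_eq, abs_lt]
  constructor <;> linarith

lemma tendsto_half_div_log :
    Tendsto (fun x : ℝ≥0 => (x : ℝ) / 2 / Real.log x) atTop atTop := by
  have h : Tendsto (fun y : ℝ => y / 2 / Real.log y) atTop atTop := by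
    have h1 : Tendsto (fun y : ℝ => Real.log y / y) atTop (𝓝[>] 0) := by
      refine tendsto_nhdsWithin_iff.2 ⟨?_, ?_⟩
      · exact Real.isLittleO_log_id_atTop.tendsto_div_nhds_zero
      · filter_upwards [eventually_gt_atTop 1] with y hy
        exact div_pos (Real.log_pos hy) (by linarith)
    refine (h1.inv_tendsto_nhdsGT_zero.const_mul_atTop (half_pos one_pos)).congr fun y => ?_
    rw [Pi.inv_apply, inv_div]
    ring
  exact h.comp (NNReal.tendsto_coe_atTop.2 tendsto_id)

lemma potentialConvergence_hermitePotential :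
    PotentialConvergence (fun n : ℕ => (n : ℝ) ^ (1 / 3 : ℝ)) hermitePotential
      (fun x => (x : ℝ) / 2) := by
  refine ⟨fun E x => match E with
    | .D => 0
    | .U => (x : ℝ) / 2
    | .L => (x : ℝ) / 2, ?_, ?_, ?_, ?_, tendsto_half_div_log⟩
  · rintro (_ | _ | _) <;> fun_prop
  · rintro (_ | _ | _) x <;> dsimp only <;> positivity
  · rintro (_ | _ | _) K hK
    · have : (fun (n : ℕ) (x : ℝ≥0) =>
          extendZero (hermitePotential .D n) ⌊(n : ℝ) ^ (1 / 3 : ℝ) * x⌋₊) = fun _ _ => 0 := by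
        funext n x
        simp [extendZero, hermitePotential]
      rw [this]
      intro u hu
      exact Eventually.of_forall fun n x _ => refl_mem_uniformity hu
    · exact tendstoUniformlyOn_hermiteOffDiagonal hK
    · exact tendstoUniformlyOn_hermiteOffDiagonal hK
  · intro x
    ring

end Hypotheses

/-! ### Entrywise matrix identities and the scaling of the spike. -/

section Matrices

lemma edgeRescale_hermite {n : ℕ} (hn : 1 ≤ n) (d : Fin (n + 1) → ℝ) (u : Fin n → ℝ) :
    edgeRescale n (hermite n d u) = -laplacian ((n : ℝ) ^ (1 / 3 : ℝ)) n +
      tridiag n d (fun a => hermiteOffDiagonal n a + u a)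
        (fun a => hermiteOffDiagonal n a + u a) := by
  have hr := (sixthRoot_pos hn).ne'
  ext i j
  simp only [edgeRescale, hermite, laplacian, tridiag, hermiteOffDiagonal, Matrix.smul_apply,
    Matrix.sub_apply, Matrix.add_apply, Matrix.neg_apply, Matrix.one_apply, smul_eq_mul,
    sqrt_eq_sixthRoot_pow, cubeRoot_eq_sixthRoot_sq]
  -- With all powers of `n` written through `r = n^{1/6} ≠ 0`, each entry is an identity rational in
  -- `r`, with `√(n-a)` a free variable.
  split_ifs <;> field_simp <;> ring

lemma edgeRescale_hermiteSpiked {n : ℕ} (hn : 1 ≤ n) (d : Fin (n + 1) → ℝ) (u : Fin n → ℝ)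
    (μ : ℝ) :
    edgeRescale n (hermiteSpiked n d u μ) =
      -laplacianSpiked ((n : ℝ) ^ (1 / 3 : ℝ)) (μ / Real.sqrt n) n +
        tridiag n d (fun a => hermiteOffDiagonal n a + u a)
          (fun a => hermiteOffDiagonal n a + u a) := by
  have hcorner : corner n (((n : ℝ) ^ (1 / 3 : ℝ)) ^ 2 * (μ / Real.sqrt n)) =
      (n : ℝ) ^ (1 / 6 : ℝ) • corner n μ := by
    have hr := (sixthRoot_pos hn).ne'
    rw [corner, corner, ← Matrix.diagonal_smul, ← Pi.single_smul, cubeRoot_eq_sixthRoot_sq,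
      sqrt_eq_sixthRoot_pow, smul_eq_mul]
    congr 2
    field_simp
  have h := edgeRescale_hermite hn d u
  rw [laplacianSpiked, hcorner, neg_add_rev, add_assoc, ← h, edgeRescale, edgeRescale,
    hermiteSpiked, ← sub_sub, smul_sub _ _ (corner n μ)]
  abel

end Matrices

lemma tendsto_cubeRoot_mul_one_sub {μ : ℕ → ℝ} {w : ℝ}
    (h : Tendsto (fun n : ℕ => (n : ℝ) ^ (-(1 / 6) : ℝ) * (Real.sqrt n - μ n)) atTop (𝓝 w)) :
    Tendsto (fun n : ℕ => (n : ℝ) ^ (1 / 3 : ℝ) * (1 - μ n / Real.sqrt n)) atTop (𝓝 w) := by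
  refine h.congr' ?_
  filter_upwards [eventually_ge_atTop 1] with n hn
  have hr := (sixthRoot_pos hn).ne'
  rw [Real.rpow_neg (Nat.cast_nonneg n), sqrt_eq_sixthRoot_pow, cubeRoot_eq_sixthRoot_sq]
  field_simp

end TridiagonalModel

theorem corollary3p5
    {Ω : ℕ → Type*} [∀ n, MeasurableSpace (Ω n)] (P : ∀ n, Measure (Ω n))
    [∀ n, IsProbabilityMeasure (P n)]
    {Ω' : Type*} [MeasurableSpace Ω'] (P' : Measure Ω') [IsProbabilityMeasure P']
    (m : ℕ → ℝ) (hm : ∀ n, m n = (n : ℝ) ^ (1 / 3 : ℝ))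
    (ξ : RandomArray Ω) (hmeas : ∀ E n a, Measurable (ξ E n a))
    (hsymm : ∀ (n : ℕ) (a : Fin n), ξ .U n a = ξ .L n a)
    (hindep : NoiseIndependence P ξ)
    (hmom : MomentAsymptotics P m ξ)
    (β : ℝ) (hβ : 0 < β)
    (W : Entry → Ω' → C(ℝ≥0, ℝ))
    (hconv : NoiseConvergence P m ξ P' W (Real.toNNReal (1 / β))) :
    ∃ (Q : RandomArray Ω) (V : PotentialArray),
      -- the unspiked ensemble
      ((∀ n : ℕ, 1 ≤ n → ∀ ω : Ω n,
          edgeRescale n (hermite n (fun a => ξ .D n a ω) (fun a => ξ .U n a ω)) =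
            -laplacian (m n) n + Q.matrix n ω) ∧
        DirichletHypotheses P m Q V ξ (fun x => (x : ℝ) / 2) P' W (Real.toNNReal (1 / β))) ∧
      -- the spiked ensemble
      (∀ (μ : ℕ → ℝ) (w : ℝ),
        Tendsto (fun n : ℕ => (n : ℝ) ^ (-(1 / 6) : ℝ) * (Real.sqrt n - μ n)) atTop (𝓝 w) →
        UniformlySubGaussian P
          (fun n ω => ξ .D n (0 : Fin (n + 1)) ω / (n : ℝ) ^ (1 / 6 : ℝ)) →
        (∀ n : ℕ, 1 ≤ n → ∀ ω : Ω n,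
          edgeRescale n (hermiteSpiked n (fun a => ξ .D n a ω) (fun a => ξ .U n a ω) (μ n)) =
            -laplacianSpiked (m n) (μ n / Real.sqrt n) n + Q.matrix n ω) ∧
        RobinHypotheses P m (fun n => μ n / Real.sqrt n) w Q V ξ (fun x => (x : ℝ) / 2)
          P' W (Real.toNNReal (1 / β))) := by
  obtain rfl : m = fun n : ℕ => (n : ℝ) ^ (1 / 3 : ℝ) := funext hm
  let Q : RandomArray Ω := fun E n a ω => hermitePotential E n a + ξ E n a ω
  have hQ : ∀ (n : ℕ) (ω : Ω n), Q.matrix n ω = tridiag n (fun a => ξ .D n a ω)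
      (fun a => hermiteOffDiagonal n a + ξ .U n a ω)
      (fun a => hermiteOffDiagonal n a + ξ .U n a ω) := by
    intro n ω
    -- The symmetry of the noise lets `ξ^U` stand in both off-diagonals, as in `hermite`.
    simp [RandomArray.matrix, Q, hermitePotential, hsymm]
  have hD : DirichletHypotheses P (fun n : ℕ => (n : ℝ) ^ (1 / 3 : ℝ)) Q hermitePotential ξ
      (fun x => (x : ℝ) / 2) P' W (Real.toNNReal (1 / β)) :=
    ⟨hmeas, fun _ _ _ _ => rfl,
      ⟨1 / 3, scaleGrowth_cubeRoot, growthLowerBounds_hermitePotential⟩,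
      potentialConvergence_hermitePotential, growthUpperBounds_hermitePotential,
      hindep, hmom, hconv⟩
  refine ⟨Q, hermitePotential, ⟨fun n hn ω => ?_, hD⟩, fun μ w hμ hsub =>
    ⟨fun n hn ω => ?_, hD, tendsto_cubeRoot_mul_one_sub hμ, ?_⟩⟩
  · rw [hQ]
    exact edgeRescale_hermite hn _ _
  · rw [hQ]
    exact edgeRescale_hermiteSpiked hn _ _ _
  -- `D_n(0) = ξ^D_n(0)` and `m^{1/2} = n^{1/6}`.
  · simpa only [Q, hermitePotential, cubeRoot_rpow_half, zero_add] using hsub
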